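/- Let $R$ be an associative ring with identity. A right coprime pair of $R$ is a pair $(a,b)\in R^2$ with $aR+bR=R$. Identify $(a,b)$ with $(a',b')$ when $aR=a'R$ and $bR=b'R$; write $\langle a,b\rangle$ for the class of $(a,b)$, call each pair in the class a pair of generators of it, and let $\mathrm{RCP}(R)$ be the set of all classes, partially ordered by $\langle a,b\rangle\le\langle a',b'\rangle$ if and only if $aR\subseteq a'R$ and $bR\subseteq b'R$. For an ordinal $\kappa$, a descending chain $\{p_\alpha\mid\alpha<\kappa\}$ in $\mathrm{RCP}(R)$ (that is, $p_\beta\le p_\alpha$ whenever $\alpha\le\beta<\kappa$) is called compatible if there are pairs of generators $(a_\alpha,b_\alpha)$ of $p_\alpha$ and elements $r_{\alpha\beta},s_{\alpha\beta}\in R$ for $\alpha<\beta<\kappa$ such that $a_\beta=a_\alpha r_{\alpha\beta}$ and $b_\beta=b_\alpha s_{\alpha\beta}$ for all $\alpha<\beta<\kappa$, and $r_{\alpha\beta}=r_{\alpha\gamma}r_{\gamma\beta}$ and $s_{\alpha\beta}=s_{\alpha\gamma}s_{\gamma\beta}$ for all $\alpha<\gamma<\beta<\kappa$. The ring $R$ is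 called right strongly exchange if for every ordinal $\kappa$ every compatible descending chain $\{p_\alpha\mid\alpha<\kappa\}$ in $\mathrm{RCP}(R)$ has a lower bound that is a minimal element of $\mathrm{RCP}(R)$. It is called left strongly exchange if it satisfies the left-right dual condition, that is, if the opposite ring $R^{\mathrm{op}}$ is right strongly exchange. Let $D$ be a division ring, let $V$ be a vector space over $D$ of countably infinite dimension, and let $S=\operatorname{End}_D(V)$ be its ring of endomorphisms, with multiplication $(fg)(v)=f(g(v))$. Then $S$ is left strongly exchange but not right strongly exchange. Consequently, the strong exchange property is not left-right symmetric: it is not true that a ring is left strongly exchange if and only if it is right strongly exchange. -/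

import Mathlib

namespace StrongExchange

/-- The principal right ideal `aR`, as a submodule of the right `R`-module `R`. -/
def rightIdeal {R : Type*} [Ring R] (a : R) : Submodule Rᵐᵒᵖ R :=
  Submodule.span Rᵐᵒᵖ {a}

/-- Pairs of elements `(a, b)` of `R` with `aR + bR = R`. -/
structure GeneratorPair (R : Type*) [Ring R] where
  a : R
  b : R
  coprime : rightIdeal a ⊔ rightIdeal b = ⊤

/-- The pair of right ideals `(aR, bR)`. -/
def GeneratorPair.ideals {R : Type*} [Ring R] (p : GeneratorPair R) :
    Submodule Rᵐᵒᵖ R × Submodule Rᵐᵒᵖ R :=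
  (rightIdeal p.a, rightIdeal p.b)

/-- `(a, b) ∼ (a', b')` if and only if `aR = a'R` and `bR = b'R`. -/
instance GeneratorPair.setoid (R : Type*) [Ring R] : Setoid (GeneratorPair R) :=
  Setoid.ker GeneratorPair.ideals

/-- `RCP(R)`: right coprime pairs `⟨a, b⟩`, considered up to the equivalence relation `∼`. -/
def RCP (R : Type*) [Ring R] : Type _ :=
  Quotient (GeneratorPair.setoid R)

/-- The class `⟨a, b⟩` of a pair of generators `(a, b)`. -/
def RCP.mk {R : Type*} [Ring R] (p : GeneratorPair R) : RCP R :=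
  Quotient.mk (GeneratorPair.setoid R) p

/-- The pair of right ideals `(aR, bR)` attached to the class `⟨a, b⟩`. -/
def RCP.ideals {R : Type*} [Ring R] : RCP R → Submodule Rᵐᵒᵖ R × Submodule Rᵐᵒᵖ R :=
  Setoid.kerLift GeneratorPair.ideals

theorem RCP.ideals_injective {R : Type*} [Ring R] :
    Function.Injective (RCP.ideals : RCP R → _) :=
  Setoid.kerLift_injective GeneratorPair.ideals

/-- `⟨a, b⟩ ≤ ⟨a', b'⟩` if and only if `aR ≤ a'R` and `bR ≤ b'R`. -/
instance RCP.partialOrder (R : Type*) [Ring R] : PartialOrder (RCP R) :=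
  PartialOrder.lift RCP.ideals RCP.ideals_injective

/-- The descending chain `{p α | α < κ}` of right coprime pairs is compatible: there are pairs
of generators `(a α, b α)` of `p α` and scalars `r α β`, `s α β` for `α < β` such that
`a β = a α * r α β`, `b β = b α * s α β` for `α < β`, and
`r α β = r α γ * r γ β`, `s α β = s α γ * s γ β` for `α < γ < β`.
(The values of `r` and `s` at arguments with `β ≤ α` play no role.) -/
def IsCompatibleDescendingChain {R : Type*} [Ring R] {κ : Ordinal}
    (p : Set.Iio κ → RCP R) : Prop :=
  Antitone p ∧
  ∃ (g : Set.Iio κ → GeneratorPair R) (r s : Set.Iio κ → Set.Iio κ → R),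
    (∀ α, RCP.mk (g α) = p α) ∧
    (∀ α β, α < β → (g β).a = (g α).a * r α β ∧ (g β).b = (g α).b * s α β) ∧
    (∀ α γ β, α < γ → γ < β → r α β = r α γ * r γ β ∧ s α β = s α γ * s γ β)

/-- A ring is right strongly exchange if every compatible descending chain of right coprime
pairs (indexed by any ordinal) has a minimal lower bound, that is, a lower bound which is a
minimal element of `RCP(R)`. -/
def IsRightStronglyExchange.{u} (R : Type u) [Ring R] : Prop :=
  ∀ (κ : Ordinal.{u}) (p : Set.Iio κ → RCP R), IsCompatibleDescendingChain p →
    ∃ q : RCP R, q ∈ lowerBounds (Set.range p) ∧ IsMin q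

/-- A ring is left strongly exchange if it satisfies the left-right dual condition, that is,
if the opposite ring is right strongly exchange. -/
def IsLeftStronglyExchange (R : Type*) [Ring R] : Prop :=
  IsRightStronglyExchange Rᵐᵒᵖ

end StrongExchange

namespace StrongExchange

/-! In the opposite of `End V`, divisibility is inclusion of kernels, so a descending chain is a
pair of increasing families of kernels, disjoint at each stage. Their unions `A`, `B` are still
disjoint; the projection `e` onto a complement of `A` containing `B`, along `A`, gives the lower
bound `(e, 1 - e)`, minimal because `e` is idempotent. In `End V` itself ranges shrink instead, and
intersections can lose coprimality. With `φ` the sum of coordinates, the hyperplane `ker φ` and each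
tail span of `e k`, `k ≥ n`, together span `V`; but the tails meet in `0`, and `ker φ` alone is not
`V`. -/

theorem mem_rightIdeal {R : Type*} [Ring R] {a x : R} : x ∈ rightIdeal a ↔ ∃ r, a * r = x := by
  rw [rightIdeal, Submodule.mem_span_singleton]
  exact ⟨fun ⟨r, hr⟩ => ⟨r.unop, hr⟩, fun ⟨r, hr⟩ => ⟨MulOpposite.op r, hr⟩⟩

theorem rightIdeal_le_iff {R : Type*} [Ring R] {a b : R} :
    rightIdeal a ≤ rightIdeal b ↔ ∃ r, b * r = a := by
  rw [← mem_rightIdeal, rightIdeal, Submodule.span_singleton_le_iff_mem]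

theorem rightIdeal_sup_eq_top_iff {R : Type*} [Ring R] {a b : R} :
    rightIdeal a ⊔ rightIdeal b = ⊤ ↔ ∃ x y, a * x + b * y = 1 := by
  constructor
  · intro h
    have h1 : (1 : R) ∈ rightIdeal a ⊔ rightIdeal b := h ▸ Submodule.mem_top
    obtain ⟨_, hu, _, hv, h1⟩ := Submodule.mem_sup.1 h1
    obtain ⟨x, rfl⟩ := mem_rightIdeal.1 hu
    obtain ⟨y, rfl⟩ := mem_rightIdeal.1 hv
    exact ⟨x, y, h1⟩
  · rintro ⟨x, y, h⟩
    refine eq_top_iff.2 fun z _ => Submodule.mem_sup.2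
      ⟨a * (x * z), mem_rightIdeal.2 ⟨_, rfl⟩, b * (y * z), mem_rightIdeal.2 ⟨_, rfl⟩, ?_⟩
    rw [← mul_assoc, ← mul_assoc, ← add_mul, h, one_mul]

theorem RCP.mk_le_mk_iff {R : Type*} [Ring R] {p q : GeneratorPair R} :
    RCP.mk p ≤ RCP.mk q ↔ (∃ r, q.a * r = p.a) ∧ ∃ s, q.b * s = p.b := by
  rw [← rightIdeal_le_iff, ← rightIdeal_le_iff]
  rfl

theorem RCP.exists_mk_eq {R : Type*} [Ring R] (p : RCP R) : ∃ g, RCP.mk g = p :=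
  Quotient.exists_rep p

/-- The right coprime pair `(e, 1 - e)`. -/
def GeneratorPair.oneSub {R : Type*} [Ring R] (e : R) : GeneratorPair R where
  a := e
  b := 1 - e
  coprime := rightIdeal_sup_eq_top_iff.2 ⟨1, 1, by simp⟩

/-- For a smaller pair `(a, b)` with `a x + b y = 1`, left multiplication by `e` fixes `a` and kills
`b`, so `a x = e` and hence `b y = 1 - e`. -/
theorem RCP.isMin_mk_oneSub {R : Type*} [Ring R] {e : R} (he : IsIdempotentElem e) :
    IsMin (RCP.mk (GeneratorPair.oneSub e)) := by
  intro q hq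
  obtain ⟨g, rfl⟩ := q.exists_mk_eq
  obtain ⟨⟨r, hr⟩, s, hs⟩ := RCP.mk_le_mk_iff.1 hq
  obtain ⟨x, y, h⟩ := rightIdeal_sup_eq_top_iff.1 g.coprime
  change e * r = g.a at hr
  change (1 - e) * s = g.b at hs
  have hx : g.a * x = e := by
    have := congrArg (e * ·) h
    simpa [← hr, ← hs, mul_add, ← mul_assoc, mul_sub, he.eq] using this
  refine RCP.mk_le_mk_iff.2 ⟨⟨x, hx⟩, y, ?_⟩
  change g.b * y = 1 - e
  rw [← h, hx, add_sub_cancel_left]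

/-- `g` factors through `V / ker f`, which `f` embeds in `V`; over a division ring this embedding
has a retraction `k`. -/
theorem exists_comp_eq_of_ker_le_ker {D V : Type*} [DivisionRing D] [AddCommGroup V] [Module D V]
    {f g : Module.End D V} (h : LinearMap.ker f ≤ LinearMap.ker g) : ∃ r, r * f = g := by
  obtain ⟨k, hk⟩ := ((LinearMap.ker f).liftQ f le_rfl).exists_leftInverse_of_injective
    (Submodule.ker_liftQ_eq_bot _ _ _ le_rfl)
  refine ⟨(LinearMap.ker f).liftQ g h ∘ₗ k, LinearMap.ext fun v => ?_⟩
  have := LinearMap.congr_fun hk ((LinearMap.ker f).mkQ v)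
  simp only [LinearMap.comp_apply, Submodule.mkQ_apply, Submodule.liftQ_apply,
    LinearMap.id_apply] at this
  simp [this]

theorem disjoint_ker_of_coprime {D V : Type*} [DivisionRing D] [AddCommGroup V] [Module D V]
    (g : GeneratorPair (Module.End D V)ᵐᵒᵖ) :
    Disjoint (LinearMap.ker g.a.unop) (LinearMap.ker g.b.unop) := by
  obtain ⟨x, y, h⟩ := rightIdeal_sup_eq_top_iff.1 g.coprime
  rw [Submodule.disjoint_def]
  intro v ha hb
  have := LinearMap.congr_fun (congrArg MulOpposite.unop h) v
  simpa [LinearMap.mem_ker.1 ha, LinearMap.mem_ker.1 hb] using this.symm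

theorem ker_unop_le_of_mul_eq {D V : Type*} [DivisionRing D] [AddCommGroup V] [Module D V]
    {a b r : (Module.End D V)ᵐᵒᵖ} (h : a * r = b) :
    LinearMap.ker a.unop ≤ LinearMap.ker b.unop := by
  subst h
  exact LinearMap.ker_le_ker_comp _ _

/-- Every descending chain of left coprime pairs in an endomorphism ring of a vector space has a
minimal lower bound. -/
theorem isLeftStronglyExchange_end (D V : Type*) [DivisionRing D] [AddCommGroup V] [Module D V] :
    IsLeftStronglyExchange (Module.End D V) := by
  rintro κ p ⟨hp, -⟩
  choose g hg using fun α => (p α).exists_mk_eq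
  have hle : ∀ α β, α ≤ β → RCP.mk (g β) ≤ RCP.mk (g α) := fun α β h => by
    rw [hg, hg]; exact hp h
  have hA : Monotone fun α => LinearMap.ker (g α).a.unop := fun α β h =>
    let ⟨_, hr⟩ := (RCP.mk_le_mk_iff.1 (hle α β h)).1
    ker_unop_le_of_mul_eq hr
  have hB : Monotone fun α => LinearMap.ker (g α).b.unop := fun α β h =>
    let ⟨_, hr⟩ := (RCP.mk_le_mk_iff.1 (hle α β h)).2
    ker_unop_le_of_mul_eq hr
  -- Both families are directed, so it suffices to compare index `α` with index `β`; both kernels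
  -- sit inside those at `max α β`.
  have hAB : Disjoint (⨆ α, LinearMap.ker (g α).a.unop) (⨆ α, LinearMap.ker (g α).b.unop) := by
    rw [hA.directed_le.disjoint_iSup_left]
    intro α
    rw [hB.directed_le.disjoint_iSup_right]
    intro β
    exact (disjoint_ker_of_coprime (g (max α β))).mono (hA (le_max_left _ _))
      (hB (le_max_right _ _))
  obtain ⟨C, hC, hcompl⟩ := hAB.symm.exists_isCompl
  let e : Module.End D V := C.projection _ hcompl
  have he : IsIdempotentElem e := Submodule.isIdempotentElem_projection hcompl
  refine ⟨RCP.mk (GeneratorPair.oneSub (MulOpposite.op e)), ?_,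
    RCP.isMin_mk_oneSub (congrArg MulOpposite.op he)⟩
  rintro _ ⟨α, rfl⟩
  have ha : LinearMap.ker (g α).a.unop ≤ LinearMap.ker e :=
    (le_iSup (fun α => LinearMap.ker (g α).a.unop) α).trans
      (Submodule.ker_projection hcompl).ge
  have hb : LinearMap.ker (g α).b.unop ≤ LinearMap.ker (1 - e) := fun v hv => by
    have hvC : v ∈ C := hC (le_iSup (fun α => LinearMap.ker (g α).b.unop) α hv)
    have hev : e v = v := Submodule.projection_apply_left hcompl ⟨v, hvC⟩
    simp [hev]
  obtain ⟨r, hr⟩ := exists_comp_eq_of_ker_le_ker ha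
  obtain ⟨s, hs⟩ := exists_comp_eq_of_ker_le_ker hb
  rw [← hg]
  exact RCP.mk_le_mk_iff.2 ⟨⟨MulOpposite.op r, congrArg MulOpposite.op hr⟩,
    MulOpposite.op s, congrArg MulOpposite.op hs⟩

/-- The endomorphism ring of a vector space with a basis indexed by `ℕ` is not right strongly
exchange. -/
theorem not_isRightStronglyExchange_end {D V : Type*} [DivisionRing D] [AddCommGroup V]
    [Module D V] (e : Module.Basis ℕ D V) :
    ¬ IsRightStronglyExchange (Module.End D V) := by
  intro h
  -- `1 - t 0` will have its range in `ker φ`, while `P n` projects onto the span of the `e k` with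
  -- `k ≥ n`.
  let φ : V →ₗ[D] D := e.constr ℕ fun _ => 1
  have hφ : ∀ n, φ (e n) = 1 := fun n => e.constr_basis ℕ _ n
  let t : ℕ → Module.End D V := fun n => (LinearMap.toSpanSingleton D V (e n)) ∘ₗ φ
  have ht : ∀ n v, t n v = φ v • e n := fun n v => rfl
  let P : ℕ → Module.End D V := fun n => e.constr ℕ fun k => if n ≤ k then e k else 0
  have hP : ∀ n k, P n (e k) = if n ≤ k then e k else 0 := fun n k => e.constr_basis ℕ _ k
  have hPP : ∀ m n, m ≤ n → P m * P n = P n := by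
    intro m n hmn
    refine e.ext fun k => ?_
    by_cases hk : n ≤ k
    · simp [hP, hk, hmn.trans hk]
    · simp [hP, hk]
  -- `φ (e n) = 1` gives `t 0 * t n = t 0`, and `P n` fixes `e n`, so `P n * t n = t n`.
  have hcop : ∀ n, (1 - t 0) * (1 - t n) + P n * t n = 1 := by
    intro n
    refine LinearMap.ext fun v => ?_
    simp [ht, hφ, hP]
  have hcoord : ∀ n v, e.coord n (P (n + 1) v) = 0 := by
    intro n v
    refine LinearMap.congr_fun (f := e.coord n ∘ₗ P (n + 1)) (g := 0) (e.ext fun k => ?_) v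
    simp only [LinearMap.comp_apply, hP, LinearMap.zero_apply]
    split_ifs with hk
    · simp [show k ≠ n by omega]
    · simp
  choose ν hν using fun α : Set.Iio Ordinal.omega0 => Ordinal.lt_omega0.1 α.2
  have hνle : ∀ α β, α < β → ν α ≤ ν β := fun α β hαβ => by
    have : (α : Ordinal) ≤ β := hαβ.le
    rw [hν, hν] at this
    exact_mod_cast this
  let g : ℕ → GeneratorPair (Module.End D V) := fun n =>
    ⟨1 - t 0, P n, rightIdeal_sup_eq_top_iff.2 ⟨_, _, hcop n⟩⟩
  obtain ⟨q, hq, -⟩ := h Ordinal.omega0 (fun α => RCP.mk (g (ν α))) ⟨by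
      intro α β hαβ
      rcases hαβ.eq_or_lt with rfl | hlt
      · exact le_rfl
      · exact RCP.mk_le_mk_iff.2 ⟨⟨1, mul_one _⟩, P (ν β), hPP _ _ (hνle _ _ hlt)⟩,
    -- Since `P γ * P β = P β` for `γ ≤ β`, the scalar `P (ν β)` depends on the target alone and the
    -- cocycle identity is automatic.
    fun α => g (ν α), fun _ _ => 1, fun _ β => P (ν β), fun _ => rfl,
    fun α β hαβ => ⟨(mul_one _).symm, (hPP _ _ (hνle _ _ hαβ)).symm⟩,
    fun α γ β _ hγβ => ⟨(mul_one _).symm, (hPP _ _ (hνle _ _ hγβ)).symm⟩⟩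
  obtain ⟨c, rfl⟩ := q.exists_mk_eq
  have hlow : ∀ n, RCP.mk c ≤ RCP.mk (g n) := by
    intro n
    have := hq ⟨⟨(n : Ordinal), Ordinal.natCast_lt_omega0 n⟩, rfl⟩
    have hn : ν ⟨(n : Ordinal), Ordinal.natCast_lt_omega0 n⟩ = n := by
      have := hν ⟨(n : Ordinal), Ordinal.natCast_lt_omega0 n⟩
      exact Nat.cast_injective this.symm
    simpa only [hn] using this
  have hb : c.b = 0 := by
    refine LinearMap.ext fun v => e.ext_elem fun n => ?_
    obtain ⟨s, hs⟩ := (RCP.mk_le_mk_iff.1 (hlow (n + 1))).2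
    rw [← hs]
    simpa using hcoord n (s v)
  obtain ⟨r, hr⟩ := (RCP.mk_le_mk_iff.1 (hlow 0)).1
  change (1 - t 0) * r = c.a at hr
  obtain ⟨x, y, hxy⟩ := rightIdeal_sup_eq_top_iff.1 c.coprime
  rw [hb, zero_mul, add_zero, ← hr] at hxy
  -- As `c.b = 0`, `(1 - t 0) * r` has a right inverse; but `φ` vanishes on its range, while `φ (e
  -- 0) = 1`.
  have := congrArg φ (LinearMap.congr_fun hxy (e 0))
  simp [ht, hφ] at this

end StrongExchange

theorem mainTheorem8 :
    (∀ (D : Type*) (V : Type*) [DivisionRing D] [AddCommGroup V] [Module D V],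
      Module.rank D V = Cardinal.aleph0 →
        StrongExchange.IsLeftStronglyExchange (Module.End D V) ∧
          ¬ StrongExchange.IsRightStronglyExchange (Module.End D V)) ∧
    ¬ (∀ (R : Type*) [Ring R],
        StrongExchange.IsLeftStronglyExchange R ↔ StrongExchange.IsRightStronglyExchange R) := by
  refine ⟨fun D V _ _ _ hV => ⟨StrongExchange.isLeftStronglyExchange_end D V, ?_⟩, fun h => ?_⟩
  · let B := Module.Basis.ofVectorSpace D V
    obtain ⟨i⟩ := Cardinal.denumerable_iff.2 (B.mk_eq_rank''.trans hV)
    exact StrongExchange.not_isRightStronglyExchange_end (B.reindex (Denumerable.eqv _))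
  -- `ULift` places the counterexample in an arbitrary universe.
  · exact StrongExchange.not_isRightStronglyExchange_end
      (Finsupp.basisSingleOne (R := ULift ℚ) (ι := ℕ))
      ((h _).1 (StrongExchange.isLeftStronglyExchange_end (ULift ℚ) (ℕ →₀ ULift ℚ)))
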